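/- For every integer $k\ge 2$, the problems $\mathsf{HPC}(k)$ and $\mathsf{WF}$ are strongly Weihrauch equivalent, $\mathsf{HPC}(k)\equiv_{\mathrm{sW}}\mathsf{WF}$. Here $\mathsf{WF}$ takes as input a tree $T\subseteq\mathbb N^{<\mathbb N}$ (a set of finite sequences closed under initial segments, given by its characteristic function) and outputs $1$ if $T$ is well-founded, i.e. has no infinite path, and $0$ otherwise. The problem $\mathsf{HPC}(k)$ takes as input a hypergraph $H=(V,E)$ with $V\subseteq\mathbb N$ and $E$ an at most countable set of subsets of $V$ of arbitrary cardinality (given by the characteristic function of $V$, that of an index set $I\subseteq\mathbb N$, and those of edges $e_i$, $i\in I$, with $E=\{e_i : i\in I\}$), and outputs $1$ if $H$ has a proper $k$-coloring and $0$ otherwise; a $k$-coloring $f:V\to\{0,\dots,k-1\}$ is proper if every edge with at least two vertices contains two vertices of different colors. An output $n\in\mathbb N$ is named by any $q\in\mathbb N^{\mathbb N}$ with $q(0)=n$. A realizer of a problem $f$ is a partial function $G:\subseteq\mathbb N^{\mathbb N}\to\mathbb N^{\mathbb N}$ that maps every name of an input of $f$ to a name of a solution. For problems $f,g$, $f\le_{\mathrm{sW}}g$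 means that there are computable partial functions $\Phi,\Psi:\subseteq\mathbb N^{\mathbb N}\to\mathbb N^{\mathbb N}$ such that $\Phi\circ G\circ\Psi$ is a realizer of $f$ for every realizer $G$ of $g$; and $f\equiv_{\mathrm{sW}}g$ means $f\le_{\mathrm{sW}}g$ and $g\le_{\mathrm{sW}}f$. -/

import Mathlib

/-- Baire space `ℕ^ℕ`. -/
abbrev Baire : Type := ℕ → ℕ

/-- Partial recursive functionals `Φ : Baire × ℕ ⇀ ℕ`, in an oracle `p` and a number, uniformly in
the oracle: the least class that contains zero, successor, the two projections and the evaluation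
`(p, n) ↦ p n`, and is closed under pairing, composition, primitive recursion and minimization.
This is `Nat.RecursiveIn` with one derivation serving all oracles simultaneously. -/
inductive RecFunctional : (Baire → ℕ →. ℕ) → Prop
  | zero : RecFunctional fun _ _ => Part.some 0
  | succ : RecFunctional fun _ n => Part.some (n + 1)
  | left : RecFunctional fun _ n => Part.some n.unpair.1
  | right : RecFunctional fun _ n => Part.some n.unpair.2
  | oracle : RecFunctional fun p n => Part.some (p n)
  | pair {Φ Ψ : Baire → ℕ →. ℕ} : RecFunctional Φ → RecFunctional Ψ →
      RecFunctional fun p n => Nat.pair <$> Φ p n <*> Ψ p n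
  | comp {Φ Ψ : Baire → ℕ →. ℕ} : RecFunctional Φ → RecFunctional Ψ →
      RecFunctional fun p n => Ψ p n >>= Φ p
  | prec {Φ Ψ : Baire → ℕ →. ℕ} : RecFunctional Φ → RecFunctional Ψ →
      RecFunctional fun p => Nat.unpaired fun a n =>
        n.rec (Φ p a) fun y IH => IH >>= fun i => Ψ p (Nat.pair a (Nat.pair y i))
  | rfind {Φ : Baire → ℕ →. ℕ} : RecFunctional Φ →
      RecFunctional fun p a => Nat.rfind fun n => (fun m => decide (m = 0)) <$> Φ p (Nat.pair a n)

/-- A partial function on Baire space is computable if one oracle algorithm computes, for every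
`p` in its domain, the value at `p` entry by entry. -/
def ComputableOnBaire (F : Baire →. Baire) : Prop :=
  ∃ Φ : Baire → ℕ →. ℕ, RecFunctional Φ ∧ ∀ p q, q ∈ F p → ∀ n, q n ∈ Φ p n

/-- A represented space: `Names` is the graph of a partial surjection from Baire space onto `X`. -/
class RepresentedSpace (X : Type*) where
  /-- `Names p x`: the point `p` of Baire space is a name of `x`. -/
  Names : Baire → X → Prop
  unique : ∀ {p : Baire} {x y : X}, Names p x → Names p y → x = y
  surjective : ∀ x : X, ∃ p : Baire, Names p x

/-- A problem: a partial multivalued function; `f x` is the set of solutions of `x`, and the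
domain is the set of `x` that have a solution. -/
abbrev Problem (X Y : Type*) : Type _ := X → Set Y

/-- `G` realizes `f`: it maps every name of every `x` in the domain of `f` to a name of a
solution. -/
def Realizes {X Y : Type*} [RepresentedSpace X] [RepresentedSpace Y]
    (G : Baire →. Baire) (f : Problem X Y) : Prop :=
  ∀ (p : Baire) (x : X), RepresentedSpace.Names p x → (f x).Nonempty →
    ∃ q ∈ G p, ∃ y ∈ f x, RepresentedSpace.Names q y

/-- Strong Weihrauch reducibility `f ≤_sW g`. -/
def StrongWeihrauchReducible {X Y Z W : Type*} [RepresentedSpace X] [RepresentedSpace Y]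
    [RepresentedSpace Z] [RepresentedSpace W] (f : Problem X Y) (g : Problem Z W) : Prop :=
  ∃ H K : Baire →. Baire, ComputableOnBaire H ∧ ComputableOnBaire K ∧
    ∀ G : Baire →. Baire, Realizes G g → Realizes (H.comp (G.comp K)) f

/-- Strong Weihrauch equivalence `f ≡_sW g`. -/
def StrongWeihrauchEquiv {X Y Z W : Type*} [RepresentedSpace X] [RepresentedSpace Y]
    [RepresentedSpace Z] [RepresentedSpace W] (f : Problem X Y) (g : Problem Z W) : Prop :=
  StrongWeihrauchReducible f g ∧ StrongWeihrauchReducible g f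

/-- The standard representation `p ↦ p 0` of `ℕ`. -/
instance : RepresentedSpace ℕ where
  Names p n := p 0 = n
  unique h₁ h₂ := h₁.symm.trans h₂
  surjective n := ⟨fun _ => n, rfl⟩

/-- The characteristic function of a set of natural numbers. -/
noncomputable def charFun (S : Set ℕ) : Baire := S.indicator 1

theorem charFun_injective : Function.Injective charFun := by
  intro S T h
  ext n
  have := congrFun h n
  by_cases h₁ : n ∈ S <;> by_cases h₂ : n ∈ T <;> simp_all [charFun]

/-- A tree on `ℕ` is named by the characteristic function of the set of codes of its nodes. -/
noncomputable instance : RepresentedSpace (Descriptive.tree ℕ) where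
  Names p T := p = charFun (Encodable.encode '' (T : Set (List ℕ)))
  unique {p x y} h₁ h₂ := by
    have := charFun_injective (h₁.symm.trans h₂)
    exact Subtype.ext (Set.image_injective.2 Encodable.encode_injective this)
  surjective T := ⟨_, rfl⟩

/-- A tree is well-founded if it has no infinite path. -/
def IsWellFoundedTree (T : Descriptive.tree ℕ) : Prop :=
  ¬ ∃ f : ℕ → ℕ, ∀ n, (List.range n).map f ∈ T

open Classical in
/-- The problem `WF`: output `1` if the given tree is well-founded, and `0` otherwise. -/
noncomputable def WF : Problem (Descriptive.tree ℕ) ℕ :=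
  fun T => {if IsWellFoundedTree T then 1 else 0}

/-- Hypergraphs with a vertex set `V ⊆ ℕ` (finite or infinite) and a finite or countably infinite
set of edges, each an arbitrary subset of `V`. -/
def CountableHypergraph : Type := {H : Hypergraph ℕ // H.edgeSet.Countable}

/-- `p` is a name of `(V, E)` if it codes the characteristic function of `V`, that of a set `I` of
indices, and that of `e i` for each `i ∈ I`, where `i ↦ e i` maps `I` onto `E`. -/
def NamesHypergraph (p : Baire) (H : CountableHypergraph) : Prop :=
  ∃ (I : Set ℕ) (e : ℕ → Set ℕ),
    (fun v => p (Nat.pair 0 v)) = charFun H.1.vertexSet ∧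
    (fun i => p (Nat.pair 1 i)) = charFun I ∧
    (∀ i ∈ I, (fun v => p (Nat.pair (i + 2) v)) = charFun (e i)) ∧
    H.1.edgeSet = e '' I

noncomputable instance : RepresentedSpace CountableHypergraph where
  Names := NamesHypergraph
  unique {p x y} h₁ h₂ := by
    obtain ⟨I, e, hV, hI, he, hE⟩ := h₁
    obtain ⟨J, d, hW, hJ, hd, hD⟩ := h₂
    obtain rfl := charFun_injective (hI.symm.trans hJ)
    refine Subtype.ext (Hypergraph.ext (charFun_injective (hV.symm.trans hW)) ?_)
    rw [hE, hD]
    exact Set.image_congr fun i hi => charFun_injective ((he i hi).symm.trans (hd i hi))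
  surjective H := by
    obtain ⟨I, e, h⟩ : ∃ (I : Set ℕ) (e : ℕ → Set ℕ), H.1.edgeSet = e '' I := by
      rcases H.1.edgeSet.eq_empty_or_nonempty with h | h
      · exact ⟨∅, fun _ => ∅, by simp [h]⟩
      · obtain ⟨e, he⟩ := H.2.exists_eq_range h
        exact ⟨Set.univ, e, by simp [he]⟩
    refine ⟨fun n => match n.unpair.1 with
      | 0 => charFun H.1.vertexSet n.unpair.2
      | 1 => charFun I n.unpair.2
      | i + 2 => charFun (e i) n.unpair.2, I, e, ?_, ?_, ?_, h⟩
    · simp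
    · simp
    · simp

/-- A `k`-coloring of the vertices is proper if every edge with at least two vertices contains
vertices of different colors. -/
def IsProperColoring (H : CountableHypergraph) {k : ℕ} (f : H.1.vertexSet → Fin k) : Prop :=
  ∀ e ∈ H.1.edgeSet, e.Nontrivial → ∃ u v : H.1.vertexSet, u.1 ∈ e ∧ v.1 ∈ e ∧ f u ≠ f v

open Classical in
/-- The problem `HPC(k)`: output `1` if the given hypergraph has a proper `k`-coloring, and `0`
otherwise. -/
noncomputable def HPC (k : ℕ) : Problem CountableHypergraph ℕ :=
  fun H => {if ∃ f : H.1.vertexSet → Fin k, IsProperColoring H f then 1 else 0}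

/-! ### Total functionals computable in an oracle -/

section OracleComputable

open Encodable

variable {α β γ σ : Type*} [Primcodable α] [Primcodable β] [Primcodable γ] [Primcodable σ]

/-! Having a proper `k`-coloring and having an infinite path are both Σ¹₁ properties, and each
translates computably into the other. Since `WF` answers 1 when no path exists, both reductions also
flip the answer (`strongWeihrauchReducible_of_negation`). From colorings to paths: that an edge is
not monochromatic is an existential condition. Guessing its two witnesses along with the coloring
leaves a closed condition on one sequence, so the guesses are the paths of a computable tree
(`exists_path_coloringTree_iff`). From paths to colorings: a path exists iff some set of lists
contains the root and, with each of its lists, a child that lies in the tree. A clique on `k - 2`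
vertices leaves two colors, read as truth values. Infinite edges then express the infinite
disjunctions "some child is true" (`exists_path_of_isProperColoring`, `isProperColoring_of_path`).
-/

theorem RecFunctional.prec_total {F G : Baire → ℕ → ℕ}
    (hF : RecFunctional fun p n => Part.some (F p n))
    (hG : RecFunctional fun p n => Part.some (G p n)) :
    RecFunctional fun p n => Part.some (Nat.unpaired (fun a n =>
      n.rec (F p a) fun y i => G p (Nat.pair a (Nat.pair y i))) n) := by
  refine (congrArg RecFunctional (funext₂ fun p n => ?_)).mp (RecFunctional.prec hF hG)
  simp only [Nat.unpaired]
  induction n.unpair.2 with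
  | zero => rfl
  | succ y ih => exact (congrArg (Part.bind · _) ih).trans (Part.bind_some _ _)

theorem RecFunctional.of_primrec {f : ℕ → ℕ} (hf : Nat.Primrec f) :
    RecFunctional fun _ n => Part.some (f n) := by
  induction hf with
  | zero => exact .zero
  | succ => exact .succ
  | left => exact .left
  | right => exact .right
  | pair _ _ ihf ihg =>
    convert RecFunctional.pair ihf ihg using 3
    simp [Seq.seq]
  | comp _ _ ihf ihg =>
    convert RecFunctional.comp ihf ihg using 3
    simp
  | prec _ _ ihf ihg => exact .prec_total ihf ihg

/-- A total functional `f`, uniformly computable in its oracle, between types of coded objects. -/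
def OracleComputable (f : Baire → α → σ) : Prop :=
  ∃ F : Baire → ℕ → ℕ, RecFunctional (fun p n => Part.some (F p n)) ∧
    ∀ p a, F p (encode a) = encode (f p a)

namespace OracleComputable

theorem of_primrec {f : α → σ} (hf : Primrec f) : OracleComputable fun _ => f :=
  -- `encode (some b)` is the successor of `encode b`; the predecessor removes this shift.
  ⟨fun _ n => (encode ((decode n : Option α).map f)).pred,
    .of_primrec (Nat.Primrec.pred.comp hf), fun p a => by simp⟩

theorem oracle : OracleComputable fun p (n : ℕ) => p n :=
  ⟨fun p n => p n, .oracle, fun _ _ => rfl⟩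

theorem comp {f : Baire → β → σ} {g : Baire → α → β} (hf : OracleComputable f)
    (hg : OracleComputable g) : OracleComputable fun p a => f p (g p a) := by
  obtain ⟨F, hF, hFf⟩ := hf
  obtain ⟨G, hG, hGg⟩ := hg
  refine ⟨fun p n => F p (G p n), ?_, fun p a => by simp only [hGg, hFf]⟩
  convert RecFunctional.comp hF hG using 3
  simp

theorem pair {f : Baire → α → β} {g : Baire → α → γ} (hf : OracleComputable f)
    (hg : OracleComputable g) : OracleComputable fun p a => (f p a, g p a) := by
  obtain ⟨F, hF, hFf⟩ := hf
  obtain ⟨G, hG, hGg⟩ := hg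
  refine ⟨fun p n => Nat.pair (F p n) (G p n), ?_, fun p a => by simp [hFf, hGg]⟩
  convert RecFunctional.pair hF hG using 3
  simp [Seq.seq]

theorem nat_rec {f : Baire → α → σ} {g : Baire → α × ℕ × σ → σ} (hf : OracleComputable f)
    (hg : OracleComputable g) :
    OracleComputable fun p (x : α × ℕ) =>
      (x.2.rec (f p x.1) fun y ih => g p (x.1, y, ih) : σ) := by
  obtain ⟨F, hF, hFf⟩ := hf
  obtain ⟨G, hG, hGg⟩ := hg
  refine ⟨fun p => Nat.unpaired fun a n =>
    n.rec (F p a) fun y i => G p (Nat.pair a (Nat.pair y i)), .prec_total hF hG, fun p x => ?_⟩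
  obtain ⟨a, n⟩ := x
  simp only [Nat.unpaired, encode_prod_val, Nat.unpair_pair, encode_nat]
  induction n with
  | zero => exact hFf p a
  | succ n ih =>
    simp only [ih]
    exact hGg p (a, n, _)

end OracleComputable

open Classical in
/-- A predicate that is decidable uniformly in the oracle. -/
def OracleDecidable (P : Baire → α → Prop) : Prop :=
  OracleComputable fun p a => decide (P p a)

namespace OracleDecidable

theorem of_primrecPred {P : α → Prop} (hP : PrimrecPred P) : OracleDecidable fun _ => P := by
  classical
  exact .of_primrec hP.decide

theorem comp {P : Baire → β → Prop} {g : Baire → α → β} (hP : OracleDecidable P)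
    (hg : OracleComputable g) : OracleDecidable fun p a => P p (g p a) :=
  OracleComputable.comp hP hg

theorem not {P : Baire → α → Prop} (hP : OracleDecidable P) :
    OracleDecidable fun p a => ¬ P p a := by
  unfold OracleDecidable
  convert (OracleComputable.of_primrec Primrec.not).comp hP using 3
  simp

theorem and {P Q : Baire → α → Prop} (hP : OracleDecidable P) (hQ : OracleDecidable Q) :
    OracleDecidable fun p a => P p a ∧ Q p a := by
  unfold OracleDecidable
  convert (OracleComputable.of_primrec Primrec.and).comp (hP.pair hQ) using 3 with p a
  by_cases h : P p a <;> by_cases h' : Q p a <;> simp [h, h']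

theorem or {P Q : Baire → α → Prop} (hP : OracleDecidable P) (hQ : OracleDecidable Q) :
    OracleDecidable fun p a => P p a ∨ Q p a := by
  unfold OracleDecidable
  convert (OracleComputable.of_primrec Primrec.or).comp (hP.pair hQ) using 3 with p a
  by_cases h : P p a <;> by_cases h' : Q p a <;> simp [h, h']

/-- The oracle, read at a primitive recursive position, has a nonzero value. -/
theorem oracle_ne_zero {g : α → ℕ} (hg : Primrec g) :
    OracleDecidable fun p a => p (g a) ≠ 0 :=
  (of_primrecPred (Primrec.eq.comp Primrec.id (Primrec.const 0)).not).comp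
    (OracleComputable.oracle.comp (.of_primrec hg))

theorem forall_lt {P : Baire → α × ℕ → Prop} (hP : OracleDecidable P) :
    OracleDecidable fun p (x : α × ℕ) => ∀ t < x.2, P p (x.1, t) := by
  classical
  have h := OracleComputable.nat_rec (α := α) (σ := Bool)
    (f := fun _ _ => true) (g := fun p x => x.2.2 && decide (P p (x.1, x.2.1)))
    (.of_primrec (Primrec.const true))
    ((OracleComputable.of_primrec Primrec.and).comp (.pair
      (.of_primrec (Primrec.snd.comp Primrec.snd))
      (OracleComputable.comp hP (.of_primrec
        (Primrec.pair Primrec.fst (Primrec.fst.comp Primrec.snd))))))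
  unfold OracleDecidable
  convert h using 3 with p x
  obtain ⟨a, n⟩ := x
  simp only
  induction n with
  | zero => simp
  | succ n ih =>
    simp only [← ih, Nat.forall_lt_succ_right, Bool.decide_and]
    congr

theorem computableOnBaire_charFun {P : Baire → ℕ → Prop} (hP : OracleDecidable P) :
    ComputableOnBaire fun p => Part.some (charFun {n | P p n}) := by
  obtain ⟨F, hF, hFP⟩ := hP
  refine ⟨_, hF, fun p q hq n => ?_⟩
  obtain rfl := Part.mem_some_iff.1 hq
  rw [Part.mem_some_iff, show F p n = _ from hFP p n]
  by_cases h : P p n <;> simp [charFun, h]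

end OracleDecidable

end OracleComputable

theorem charFun_ne_zero_iff {S : Set ℕ} {n : ℕ} : charFun S n ≠ 0 ↔ n ∈ S := by
  by_cases h : n ∈ S <;> simp [charFun, h]

/-! ### Reductions between decision problems -/

/-- The map that exchanges the answers `0` and `1` is computable. -/
theorem computableOnBaire_negation :
    ComputableOnBaire fun q => Part.some fun _ => 1 - q 0 := by
  have h : OracleComputable fun p (_ : ℕ) => 1 - p 0 :=
    (OracleComputable.of_primrec (Primrec.nat_sub.comp (Primrec.const 1) Primrec.id)).comp
      (OracleComputable.oracle.comp (.of_primrec (Primrec.const 0)))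
  obtain ⟨F, hF, hFf⟩ := h
  refine ⟨_, hF, fun p q hq n => ?_⟩
  obtain rfl := Part.mem_some_iff.1 hq
  rw [Part.mem_some_iff]
  exact (hFf p n).symm

open Classical in
/-- A computable transformation of names that turns instances with answer yes into instances with
answer no and vice versa is a strong Weihrauch reduction. -/
theorem strongWeihrauchReducible_of_negation {X Z : Type*} [RepresentedSpace X]
    [RepresentedSpace Z] {A : X → Prop} {B : Z → Prop} {F : Baire → Baire}
    (hF : ComputableOnBaire fun p => Part.some (F p))
    (h : ∀ p x, RepresentedSpace.Names p x →
      ∃ z : Z, RepresentedSpace.Names (F p) z ∧ (A x ↔ ¬ B z)) :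
    StrongWeihrauchReducible (fun x => ({if A x then 1 else 0} : Set ℕ))
      (fun z => ({if B z then 1 else 0} : Set ℕ)) := by
  refine ⟨_, _, computableOnBaire_negation, hF, fun G hG p x hp _ => ?_⟩
  obtain ⟨z, hz, hAB⟩ := h p x hp
  obtain ⟨q, hq, y, rfl, hqy⟩ := hG (F p) z hz (Set.singleton_nonempty _)
  refine ⟨fun _ => 1 - q 0, ?_, _, rfl, ?_⟩
  · exact Part.mem_bind (Part.mem_bind (Part.mem_some _) hq) (Part.mem_some _)
  · change q 0 = _ at hqy
    change 1 - q 0 = _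
    by_cases hB : B z <;> simp_all

/-! ### Colorability is reducible to well-foundedness -/

section ColoringTree

/-- The constraint with index `t = ⟨i, a, b⟩` on a finite approximation `s` of a coloring with
witnesses: if `i` is the index of an edge that contains the distinct vertices `a` and `b`, then the
entry `s t = ⟨c, u, v⟩` names vertices `u`, `v` of that edge that do not receive the same color, as
far as `s` determines this. The color of a vertex `w` is the first component of `s w` modulo `k`. -/
def ColoringConstraint (k : ℕ) (p : Baire) (s : List ℕ) (t : ℕ) : Prop :=
  let i := t.unpair.1
  let ab := t.unpair.2.unpair
  let uv := (s.getD t 0).unpair.2.unpair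
  ¬ (p (Nat.pair 1 i) ≠ 0 ∧ p (Nat.pair (i + 2) ab.1) ≠ 0 ∧ p (Nat.pair (i + 2) ab.2) ≠ 0 ∧
      ab.1 ≠ ab.2) ∨
    (p (Nat.pair (i + 2) uv.1) ≠ 0 ∧ p (Nat.pair (i + 2) uv.2) ≠ 0 ∧
      (s.length ≤ uv.1 ∨ s.length ≤ uv.2 ∨
        (s.getD uv.1 0).unpair.1 % k ≠ (s.getD uv.2 0).unpair.1 % k))

/-- Shortening `s` only weakens the constraint: a witness that falls outside the shorter list
satisfies it by default. This is what makes the approximations a tree. -/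
theorem ColoringConstraint.of_append {k : ℕ} {p : Baire} {s r : List ℕ} {t : ℕ}
    (ht : t < s.length) (h : ColoringConstraint k p (s ++ r) t) : ColoringConstraint k p s t := by
  unfold ColoringConstraint at h ⊢
  simp only [List.getD_append _ _ _ _ ht] at h
  refine h.imp_right fun ⟨hu, hv, h⟩ => ⟨hu, hv, ?_⟩
  by_cases h₁ : s.length ≤ (s.getD t 0).unpair.2.unpair.1
  · exact .inl h₁
  by_cases h₂ : s.length ≤ (s.getD t 0).unpair.2.unpair.2
  · exact .inr (.inl h₂)
  rw [List.getD_append _ _ _ _ (not_le.1 h₁), List.getD_append _ _ _ _ (not_le.1 h₂),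
    List.length_append] at h
  omega

/-- The tree of finite approximations of colorings with witnesses of the hypergraph named `p`. -/
def coloringTree (k : ℕ) (p : Baire) : Descriptive.tree ℕ :=
  ⟨{s | ∀ t < s.length, ColoringConstraint k p s t}, fun s a h t ht =>
    (h t (by simp; omega)).of_append ht⟩

theorem mem_coloringTree {k : ℕ} {p : Baire} {s : List ℕ} :
    s ∈ coloringTree k p ↔ ∀ t < s.length, ColoringConstraint k p s t :=
  Iff.rfl

theorem oracleDecidable_coloringConstraint (k : ℕ) :
    OracleDecidable fun p (x : List ℕ × ℕ) => ColoringConstraint k p x.1 x.2 := by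
  have unp {f : List ℕ × ℕ → ℕ} (hf : Primrec f) : Primrec fun x => (f x).unpair :=
    Primrec.unpair.comp hf
  have edge {f g : List ℕ × ℕ → ℕ} (hf : Primrec f) (hg : Primrec g) :
      OracleDecidable fun p x => p (Nat.pair (f x) (g x)) ≠ 0 :=
    .oracle_ne_zero (Primrec₂.natPair.comp hf hg)
  have entry {f : List ℕ × ℕ → ℕ} (hf : Primrec f) :
      Primrec fun x : List ℕ × ℕ => x.1.getD (f x) 0 :=
    (Primrec.list_getD 0).comp Primrec.fst hf
  have color {f : List ℕ × ℕ → ℕ} (hf : Primrec f) :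
      Primrec fun x : List ℕ × ℕ => (x.1.getD (f x) 0).unpair.1 % k :=
    Primrec.nat_mod.comp (Primrec.fst.comp (unp (entry hf))) (Primrec.const k)
  have len : Primrec fun x : List ℕ × ℕ => x.1.length := Primrec.list_length.comp Primrec.fst
  have index : Primrec fun x : List ℕ × ℕ => x.2.unpair.1 := Primrec.fst.comp (unp Primrec.snd)
  have row : Primrec fun x : List ℕ × ℕ => x.2.unpair.1 + 2 :=
    Primrec.nat_add.comp index (Primrec.const 2)
  have ab := unp (Primrec.snd.comp (unp Primrec.snd))
  have uv := unp (Primrec.snd.comp (unp (entry Primrec.snd)))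
  have a := Primrec.fst.comp ab
  have b := Primrec.snd.comp ab
  have u := Primrec.fst.comp uv
  have v := Primrec.snd.comp uv
  exact ((edge (Primrec.const 1) index).and <| (edge row a).and <| (edge row b).and <|
      .of_primrecPred (Primrec.eq.comp a b).not).not.or <|
    (edge row u).and <| (edge row v).and <| .of_primrecPred <|
      (Primrec.nat_le.comp len u).or <| (Primrec.nat_le.comp len v).or
        (Primrec.eq.comp (color u) (color v)).not

/-- Every number codes a list, so membership can be decided by decoding, without searching for a
preimage. -/
theorem encode_image_eq (T : Set (List ℕ)) :
    Encodable.encode '' T = {n | Denumerable.ofNat (List ℕ) n ∈ T} := by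
  ext n
  refine ⟨?_, fun h => ⟨_, h, Denumerable.encode_ofNat n⟩⟩
  rintro ⟨s, hs, rfl⟩
  simpa using hs

theorem computableOnBaire_coloringTree (k : ℕ) :
    ComputableOnBaire fun p =>
      Part.some (charFun (Encodable.encode '' (coloringTree k p : Set (List ℕ)))) := by
  simp only [encode_image_eq]
  exact ((oracleDecidable_coloringConstraint k).forall_lt.comp (.of_primrec
    (Primrec.pair (Primrec.ofNat (List ℕ))
      (Primrec.list_length.comp (Primrec.ofNat (List ℕ)))))).computableOnBaire_charFun

theorem exists_path_coloringTree_iff {k : ℕ} (hk : 0 < k) {p : Baire} {H : CountableHypergraph}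
    (hp : NamesHypergraph p H) :
    (∃ f : ℕ → ℕ, ∀ n, (List.range n).map f ∈ coloringTree k p) ↔
      ∃ c : H.1.vertexSet → Fin k, IsProperColoring H c := by
  obtain ⟨I, e, -, hI, he, hE⟩ := hp
  have hI' (i : ℕ) : p (Nat.pair 1 i) ≠ 0 ↔ i ∈ I := by
    rw [← charFun_ne_zero_iff, ← hI]
  have he' {i : ℕ} (hi : i ∈ I) (v : ℕ) : p (Nat.pair (i + 2) v) ≠ 0 ↔ v ∈ e i := by
    rw [← charFun_ne_zero_iff, ← he i hi]
  have hsub {i : ℕ} (hi : i ∈ I) : e i ⊆ H.1.vertexSet :=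
    H.1.subset_vertexSet_of_mem_edgeSet' (hE ▸ ⟨i, hi, rfl⟩)
  have getD_map (f : ℕ → ℕ) {n t : ℕ} (h : t < n) : ((List.range n).map f).getD t 0 = f t := by
    simp [List.getD, h]
  constructor
  · rintro ⟨f, hf⟩
    refine ⟨fun v => ⟨(f v).unpair.1 % k, Nat.mod_lt _ hk⟩, ?_⟩
    rw [IsProperColoring, hE]
    rintro _ ⟨i, hi, rfl⟩ ⟨a, ha, b, hb, hab⟩
    set t := Nat.pair i (Nat.pair a b) with ht
    set u := (f t).unpair.2.unpair.1 with hu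
    set v := (f t).unpair.2.unpair.2 with hv
    -- A segment of this length contains the entries `t`, `u` and `v`, so neither length escape in
    -- the constraint applies.
    have hn : t < t + u + v + 1 := by omega
    have h := mem_coloringTree.1 (hf (t + u + v + 1)) t (by simpa using hn)
    simp only [ColoringConstraint, getD_map f hn, ← hu, ← hv,
      getD_map f (show u < t + u + v + 1 by omega), getD_map f (show v < t + u + v + 1 by omega),
      List.length_map, List.length_range] at h
    simp only [ht, Nat.unpair_pair, hI', he' hi] at h
    obtain ⟨hu', hv', h⟩ := h.resolve_left (not_not.2 ⟨hi, ha, hb, hab⟩)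
    refine ⟨⟨u, hsub hi hu'⟩, ⟨v, hsub hi hv'⟩, hu', hv', fun h' => ?_⟩
    have := Fin.mk.inj_iff.1 h'
    grind
  · rintro ⟨c, hc⟩
    classical
    have key (t : ℕ) : ∃ w : ℕ, t.unpair.1 ∈ I → (e t.unpair.1).Nontrivial →
        ∃ (u v : H.1.vertexSet), w.unpair = (u.1, v.1) ∧ u.1 ∈ e t.unpair.1 ∧
          v.1 ∈ e t.unpair.1 ∧ c u ≠ c v := by
      by_cases h : t.unpair.1 ∈ I ∧ (e t.unpair.1).Nontrivial
      · obtain ⟨u, v, hu, hv, huv⟩ := hc _ (hE ▸ ⟨_, h.1, rfl⟩) h.2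
        exact ⟨Nat.pair u v, fun _ _ => ⟨u, v, by simp, hu, hv, huv⟩⟩
      · exact ⟨0, fun h₁ h₂ => absurd ⟨h₁, h₂⟩ h⟩
    choose w hw using key
    -- The default 0 is harmless: only colors of witnesses are compared, and these are vertices.
    let C (v : ℕ) : ℕ := if h : v ∈ H.1.vertexSet then c ⟨v, h⟩ else 0
    have hC (v : H.1.vertexSet) : C v = c v := by simp [C]
    refine ⟨fun t => Nat.pair (C t) (w t), fun n => mem_coloringTree.2 fun t ht => ?_⟩
    rw [List.length_map, List.length_range] at ht
    simp only [ColoringConstraint, getD_map _ ht, Nat.unpair_pair, List.length_map,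
      List.length_range]
    refine or_iff_not_imp_left.2 fun h => ?_
    obtain ⟨hi, ha, hb, hab⟩ := not_not.1 h
    rw [hI'] at hi
    rw [he' hi] at ha hb
    obtain ⟨u, v, hwt, hu, hv, huv⟩ := hw t hi ⟨_, ha, _, hb, hab⟩
    rw [hwt, he' hi, he' hi]
    refine ⟨hu, hv, ?_⟩
    rcases le_or_gt n u.1 with h₁ | h₁
    · exact .inl h₁
    rcases le_or_gt n v.1 with h₂ | h₂
    · exact .inr (.inl h₂)
    refine .inr (.inr ?_)
    simp only [getD_map _ h₁, getD_map _ h₂, Nat.unpair_pair, hC,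
      Nat.mod_eq_of_lt (c u).2, Nat.mod_eq_of_lt (c v).2]
    exact Fin.val_ne_of_ne huv

theorem hpc_strongWeihrauchReducible_wf {k : ℕ} (hk : 0 < k) :
    StrongWeihrauchReducible (HPC k) WF :=
  strongWeihrauchReducible_of_negation (computableOnBaire_coloringTree k) fun p _ hp =>
    ⟨coloringTree k p, rfl, by
      rw [IsWellFoundedTree, not_not, exists_path_coloringTree_iff hk hp]⟩

end ColoringTree

/-! ### Well-foundedness is reducible to colorability -/

section TreeHypergraph

open Encodable

/-- The vertices `v < m` form a clique whose vertices are joined to all other vertices, so that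
only two of `m + 2` colors remain for the others: a vertex `m` colored with the truth value
false, and for every code `c` of a list a pair of literals `m + 1 + 2 * c`, `m + 2 + 2 * c` with
opposite truth values. The edges with `i.unpair.1 = 2` say that a true positive literal `j` has a
child in `A` that is true, where the children of the list `l` are the lists `a :: l`, and the edge
with `i.unpair.1 = 3` says that the positive literal of the empty list is true. -/
def treeEdge (m : ℕ) (A : Set ℕ) (i : ℕ) : Set ℕ :=
  {v | (i.unpair.1 = 0 ∧ i.unpair.2.unpair.1 < m ∧
      (v = i.unpair.2.unpair.1 ∨ v = i.unpair.2.unpair.2)) ∨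
    (i.unpair.1 = 1 ∧ (v = m + 1 + 2 * i.unpair.2 ∨ v = m + 2 + 2 * i.unpair.2)) ∨
    (i.unpair.1 = 2 ∧ (v = m ∨ v = m + 2 + 2 * i.unpair.2 ∨
      (v = m + 1 + 2 * ((v - (m + 1)) / 2) ∧ (v - (m + 1)) / 2 ≠ 0 ∧
        ((v - (m + 1)) / 2 - 1).unpair.2 = i.unpair.2 ∧ (v - (m + 1)) / 2 ∈ A))) ∨
    (i.unpair.1 = 3 ∧ (v = m ∨ v = m + 1))}

theorem treeEdge_clique {m a : ℕ} (A : Set ℕ) (ha : a < m) (b : ℕ) :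
    treeEdge m A (Nat.pair 0 (Nat.pair a b)) = {a, b} := by
  ext v
  simp [treeEdge, ha]

theorem treeEdge_literal (m : ℕ) (A : Set ℕ) (j : ℕ) :
    treeEdge m A (Nat.pair 1 j) = {m + 1 + 2 * j, m + 2 + 2 * j} := by
  ext v
  simp [treeEdge]

/-- The code of `a :: l` is the successor of the pair of `a` and the code of `l`. Hence "being a
child of `l`" is a test on one number, and `treeEdge` needs no quantifier over `a`. -/
theorem treeEdge_clause (m : ℕ) (A : Set ℕ) (l : List ℕ) :
    treeEdge m A (Nat.pair 2 (encode l)) =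
      {v | v = m ∨ v = m + 2 + 2 * encode l ∨
        ∃ a : ℕ, v = m + 1 + 2 * encode (a :: l) ∧ encode (a :: l) ∈ A} := by
  ext v
  simp only [treeEdge, Nat.unpair_pair, Set.mem_ofPred_eq]
  have h (c : ℕ) : c ≠ 0 ∧ (c - 1).unpair.2 = encode l ∧ c ∈ A ↔
      ∃ a : ℕ, c = encode (a :: l) ∧ encode (a :: l) ∈ A := by
    constructor
    · rintro ⟨h₀, hl, hA⟩
      have : c = encode ((c - 1).unpair.1 :: l) := by
        rw [encode_list_cons, encode_nat, ← hl, Nat.pair_unpair]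
        omega
      exact ⟨_, this, this ▸ hA⟩
    · rintro ⟨a, rfl, hA⟩
      exact ⟨by simp, by simp, hA⟩
  rw [h]
  simp only [OfNat.ofNat_ne_zero, false_and, OfNat.ofNat_ne_one, true_and, false_or,
    Nat.reduceEqDiff, or_false]
  refine or_congr_right (or_congr_right ⟨?_, ?_⟩)
  · rintro ⟨hv, a, hc, hA⟩
    exact ⟨a, hc ▸ hv, hA⟩
  · rintro ⟨a, rfl, hA⟩
    exact ⟨by omega, a, by omega, hA⟩

theorem treeEdge_root (m : ℕ) (A : Set ℕ) (j : ℕ) :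
    treeEdge m A (Nat.pair 3 j) = {m, m + 1} := by
  ext v
  simp [treeEdge]

/-- The hypergraph with vertex set `ℕ` and the edges `treeEdge m A`. -/
def treeHypergraph (m : ℕ) (A : Set ℕ) : CountableHypergraph :=
  ⟨⟨Set.univ, Set.range (treeEdge m A), fun _ _ => Set.subset_univ _⟩, Set.countable_range _⟩

/-! ### From proper colorings to paths -/

/-- Pigeonhole: the `m` clique colors together with those of `u` and `v` are distinct and exhaust
all `m + 2`, and `w` must avoid the clique colors. -/
theorem two_colors_off_clique {m : ℕ} {c : ℕ → Fin (m + 2)}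
    (hc : ∀ a < m, ∀ b, a ≠ b → c a ≠ c b) {u v w : ℕ} (hu : m ≤ u) (hv : m ≤ v) (hw : m ≤ w)
    (huv : c u ≠ c v) : c w = c u ∨ c w = c v := by
  have hinj : Set.InjOn c (Finset.range m) := fun a ha b _ h => by
    by_contra hab
    exact hc a (by simpa using ha) b hab h
  have hnot {x : ℕ} (hx : m ≤ x) : c x ∉ (Finset.range m).image c := by
    simp only [Finset.mem_image, Finset.mem_range, not_exists, not_and]
    exact fun a ha => hc a ha x (by omega)
  have hcard : (insert (c u) (insert (c v) ((Finset.range m).image c))).card = m + 2 := by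
    rw [Finset.card_insert_of_notMem (by simp [huv, hnot hu, -Finset.mem_image]),
      Finset.card_insert_of_notMem (hnot hv), Finset.card_image_of_injOn hinj, Finset.card_range]
  have huniv := Finset.eq_univ_of_card _ (hcard.trans (Fintype.card_fin _).symm)
  have := huniv ▸ Finset.mem_univ (c w)
  simpa [hnot hw, -Finset.mem_image] using this

/-- A hereditarily extendable property of lists, written in reverse, has an infinite path. -/
theorem exists_path_of_forall_exists_cons {α : Type*} {P : List α → Prop} (h₀ : P [])
    (h : ∀ l, P l → ∃ a, P (a :: l)) :
    ∃ f : ℕ → α, ∀ n, P ((List.range n).map f).reverse := by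
  choose next hnext using h
  let g : ℕ → {l : List α // P l} := fun n =>
    n.rec ⟨[], h₀⟩ fun _ l => ⟨next l.1 l.2 :: l.1, hnext l.1 l.2⟩
  refine ⟨fun n => next (g n).1 (g n).2, fun n => ?_⟩
  suffices h : ((List.range n).map fun n => next (g n).1 (g n).2).reverse = (g n).1 from
    h ▸ (g n).2
  induction n with
  | zero => rfl
  | succ n ih =>
    rw [List.range_succ, List.map_append, List.reverse_append, ih]
    rfl

/-- Call a list true if its positive literal differs in color from `m`. The root is true and every
true list has a true child in `A`, so dependent choice gives a path. Children are formed by `cons`,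
hence the reversal in `hA`. -/
theorem exists_path_of_isProperColoring {m : ℕ} {A : Set ℕ} {T : Descriptive.tree ℕ}
    (hA : ∀ l : List ℕ, encode l ∈ A ↔ l.reverse ∈ T)
    {c : (treeHypergraph m A).1.vertexSet → Fin (m + 2)}
    (hc : IsProperColoring (treeHypergraph m A) c) :
    ∃ f : ℕ → ℕ, ∀ n, (List.range n).map f ∈ T := by
  let d (v : ℕ) : Fin (m + 2) := c ⟨v, trivial⟩
  have hd (i : ℕ) (hi : (treeEdge m A i).Nontrivial) :
      ∃ u ∈ treeEdge m A i, ∃ v ∈ treeEdge m A i, d u ≠ d v := by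
    obtain ⟨u, v, hu, hv, huv⟩ := hc _ ⟨i, rfl⟩ hi
    exact ⟨u, hu, v, hv, huv⟩
  have hpair {i u v : ℕ} (hi : treeEdge m A i = {u, v}) (huv : u ≠ v) : d u ≠ d v := by
    have := hd i (hi ▸ Set.nontrivial_pair huv)
    rw [hi] at this
    grind
  have hclique : ∀ a < m, ∀ b, a ≠ b → d a ≠ d b := fun a ha b hab =>
    hpair (treeEdge_clique A ha b) hab
  have hlit (j : ℕ) : d (m + 1 + 2 * j) ≠ d (m + 2 + 2 * j) :=
    hpair (treeEdge_literal m A j) (by omega)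
  have hroot : d m ≠ d (m + 1) := hpair (treeEdge_root m A 0) (by omega)
  have hclause (l : List ℕ) (hl : d (m + 1 + 2 * encode l) ≠ d m) :
      ∃ a : ℕ, d (m + 1 + 2 * encode (a :: l)) ≠ d m ∧ encode (a :: l) ∈ A := by
    -- Only two colors remain, so the negative literal of a true list is false. Without a true child
    -- in `A` the clause edge would then be monochromatic.
    have hm : d m = d (m + 2 + 2 * encode l) :=
      (two_colors_off_clique hclique (by omega) (by omega) le_rfl (hlit _)).resolve_left hl.symm
    have := hd (Nat.pair 2 (encode l)) (by
      rw [treeEdge_clause]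
      exact ⟨m, .inl rfl, m + 2 + 2 * encode l, .inr (.inl rfl), by omega⟩)
    rw [treeEdge_clause] at this
    by_contra! hne
    have key : ∀ v ∈ {v | v = m ∨ v = m + 2 + 2 * encode l ∨
        ∃ a : ℕ, v = m + 1 + 2 * encode (a :: l) ∧ encode (a :: l) ∈ A}, d v = d m := by
      rintro v (rfl | rfl | ⟨a, rfl, ha⟩)
      · rfl
      · exact hm.symm
      · by_contra h
        exact hne a h ha
    obtain ⟨u, hu, v, hv, huv⟩ := this
    exact huv ((key u hu).trans (key v hv).symm)
  obtain ⟨f, hf⟩ := exists_path_of_forall_exists_cons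
    -- Membership in `A` comes from being chosen as a child, so it is not yet known for the root.
    -- The step to length `n + 1` below recovers it by closure under prefixes.
    (P := fun l : List ℕ => d (m + 1 + 2 * encode l) ≠ d m ∧ (l ≠ [] → encode l ∈ A))
    ⟨by simpa using hroot.symm, fun h => absurd rfl h⟩ fun l hl => by
      obtain ⟨a, ha, haA⟩ := hclause l hl.1
      exact ⟨a, ha, fun _ => haA⟩
  refine ⟨f, fun n => Descriptive.Tree.mem_of_append (y := [f n]) ?_⟩
  have := (hf (n + 1)).2 (by simp)
  rw [hA, List.reverse_reverse, List.range_succ, List.map_append] at this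
  exact this

/-! ### From paths to proper colorings -/

open Classical in
/-- The coloring of `treeHypergraph` in which the true positive literals are those in `S`. -/
noncomputable def treeColoring (m : ℕ) (S : Set ℕ) (v : ℕ) : Fin (m + 2) :=
  if h : v < m then ⟨v, by omega⟩
  else if v ≠ m ∧ ((v - (m + 1)) / 2 ∈ S ↔ (v - (m + 1)) % 2 = 0) then ⟨m, by omega⟩
  else ⟨m + 1, by omega⟩

theorem treeColoring_clique {m a b : ℕ} (S : Set ℕ) (ha : a < m) (hab : a ≠ b) :
    treeColoring m S a ≠ treeColoring m S b := by
  unfold treeColoring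
  grind

/-- Color `m` stands for true and `m + 1` for false. The guard `v ≠ m` in `treeColoring` matters: by
truncated subtraction, vertex `m` would otherwise be treated as the positive literal of code 0. -/
theorem treeColoring_false (m : ℕ) (S : Set ℕ) :
    treeColoring m S m = ⟨m + 1, by omega⟩ := by
  simp [treeColoring]

open Classical in
theorem treeColoring_pos (m : ℕ) (S : Set ℕ) (j : ℕ) :
    treeColoring m S (m + 1 + 2 * j) = if j ∈ S then ⟨m, by omega⟩ else ⟨m + 1, by omega⟩ := by
  have h₁ : ¬ m + 1 + 2 * j < m := by omega
  have h₂ : m + 1 + 2 * j ≠ m := by omega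
  have h₃ : (m + 1 + 2 * j - (m + 1)) / 2 = j := by omega
  have h₄ : (m + 1 + 2 * j - (m + 1)) % 2 = 0 := by omega
  simp only [treeColoring, h₁, h₂, h₃, h₄, dif_neg, not_false_eq_true, true_and, iff_true, ne_eq]

open Classical in
theorem treeColoring_neg (m : ℕ) (S : Set ℕ) (j : ℕ) :
    treeColoring m S (m + 2 + 2 * j) = if j ∈ S then ⟨m + 1, by omega⟩ else ⟨m, by omega⟩ := by
  have h₁ : ¬ m + 2 + 2 * j < m := by omega
  have h₂ : m + 2 + 2 * j ≠ m := by omega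
  have h₃ : (m + 2 + 2 * j - (m + 1)) / 2 = j := by omega
  have h₄ : (m + 2 + 2 * j - (m + 1)) % 2 ≠ 0 := by omega
  by_cases h : j ∈ S <;>
    simp only [treeColoring, h₁, h₂, h₃, h₄, h, dif_neg, not_false_eq_true, true_and, iff_false,
      ne_eq, if_true, if_false, not_true_eq_false]

/-- The true lists are the reversed initial segments of `f`. In a clause edge the vertex differing
from `m` is the next segment if `l` is such a segment, and otherwise the negative literal of `l`. -/
theorem isProperColoring_of_path {m : ℕ} {A : Set ℕ} {T : Descriptive.tree ℕ}
    (hA : ∀ l : List ℕ, encode l ∈ A ↔ l.reverse ∈ T) {f : ℕ → ℕ}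
    (hf : ∀ n, (List.range n).map f ∈ T) :
    IsProperColoring (treeHypergraph m A)
      fun v => treeColoring m (Set.range fun n => encode ((List.range n).map f).reverse) v := by
  set S := Set.range fun n => encode ((List.range n).map f).reverse
  suffices H : ∀ i, (treeEdge m A i).Nontrivial →
      ∃ u ∈ treeEdge m A i, ∃ v ∈ treeEdge m A i, treeColoring m S u ≠ treeColoring m S v by
    rintro _ ⟨i, rfl⟩ hi
    obtain ⟨u, hu, v, hv, huv⟩ := H i hi
    exact ⟨⟨u, trivial⟩, ⟨v, trivial⟩, hu, hv, huv⟩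
  intro i hi
  obtain ⟨t, j, rfl⟩ : ∃ t j, i = Nat.pair t j := ⟨_, _, (Nat.pair_unpair i).symm⟩
  -- All other tags give the empty edge. Likewise below, a clique index with `a ≥ m` gives the empty
  -- edge, and `a = b` a singleton.
  have ht : t = 0 ∨ t = 1 ∨ t = 2 ∨ t = 3 := by
    obtain ⟨v, hv⟩ := hi.nonempty
    simp only [treeEdge, Nat.unpair_pair, Set.mem_ofPred_eq] at hv
    tauto
  rcases ht with rfl | rfl | rfl | rfl
  · obtain ⟨a, b, rfl⟩ : ∃ a b, j = Nat.pair a b := ⟨_, _, (Nat.pair_unpair j).symm⟩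
    have ha : a < m := by
      obtain ⟨v, hv⟩ := hi.nonempty
      simp only [treeEdge, Nat.unpair_pair, Set.mem_ofPred_eq] at hv
      omega
    rw [treeEdge_clique A ha] at hi ⊢
    have hab : a ≠ b := by
      rintro rfl
      simp at hi
    exact ⟨a, by simp, b, by simp, treeColoring_clique S ha hab⟩
  · rw [treeEdge_literal]
    refine ⟨_, .inl rfl, _, .inr rfl, ?_⟩
    rw [treeColoring_pos, treeColoring_neg]
    by_cases h : j ∈ S <;> simp [h]
  · obtain ⟨l, rfl⟩ : ∃ l : List ℕ, j = encode l := ⟨_, (Denumerable.encode_ofNat j).symm⟩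
    rw [treeEdge_clause]
    by_cases h : encode l ∈ S
    · obtain ⟨n, hn⟩ := h
      obtain rfl := encode_injective hn
      have hcons : f n :: ((List.range n).map f).reverse =
          ((List.range (n + 1)).map f).reverse := by
        simp [List.range_succ]
      refine ⟨m, .inl rfl, _, .inr (.inr ⟨f n, rfl, ?_⟩), ?_⟩
      · rw [hA, hcons, List.reverse_reverse]
        exact hf _
      · rw [treeColoring_false, treeColoring_pos, if_pos (hcons ▸ ⟨n + 1, rfl⟩)]
        simp
    · refine ⟨m, .inl rfl, _, .inr (.inl rfl), ?_⟩
      rw [treeColoring_false, treeColoring_neg, if_neg h]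
      simp
  · rw [treeEdge_root]
    refine ⟨m, .inl rfl, m + 1, .inr rfl, ?_⟩
    -- The empty list has code 0 and is the segment of length 0, so its positive literal `m + 1` is
    -- true.
    have h := treeColoring_pos m S 0
    rw [if_pos ⟨0, rfl⟩] at h
    rw [treeColoring_false, show treeColoring m S (m + 1) = _ from h]
    simp

/-! ### Computing the hypergraph from the tree -/

/-- The codes of the lists whose reverse is in the tree with characteristic function `p`. -/
def reversedNodes (p : Baire) : Set ℕ :=
  {c | p (encode (Denumerable.ofNat (List ℕ) c).reverse) ≠ 0}

/-- The set whose characteristic function is a name of `treeHypergraph m (reversedNodes p)`. -/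
def treeHypergraphCode (m : ℕ) (p : Baire) : Set ℕ :=
  {n | n.unpair.1 = 0 ∨ n.unpair.1 = 1 ∨
    n.unpair.2 ∈ treeEdge m (reversedNodes p) (n.unpair.1 - 2)}

theorem computableOnBaire_treeHypergraphCode (m : ℕ) :
    ComputableOnBaire fun p => Part.some (charFun (treeHypergraphCode m p)) := by
  have unp {f : ℕ → ℕ} (hf : Primrec f) : Primrec fun x => (f x).unpair := Primrec.unpair.comp hf
  have eq {f g : ℕ → ℕ} (hf : Primrec f) (hg : Primrec g) : PrimrecPred fun n => f n = g n :=
    Primrec.eq.comp hf hg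
  have lin {f : ℕ → ℕ} (a : ℕ) (hf : Primrec f) : Primrec fun n => a + 2 * f n :=
    Primrec.nat_add.comp (Primrec.const a) (Primrec.nat_double.comp hf)
  have hm := Primrec.const (α := ℕ) m
  have row := Primrec.fst.comp (unp Primrec.id)
  have v := Primrec.snd.comp (unp Primrec.id)
  have i := unp (Primrec.nat_sub.comp row (Primrec.const 2))
  have tag := Primrec.fst.comp i
  have j := Primrec.snd.comp i
  have ab := unp j
  have a := Primrec.fst.comp ab
  have b := Primrec.snd.comp ab
  have c := Primrec.nat_div.comp (Primrec.nat_sub.comp v (Primrec.const (m + 1)))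
    (Primrec.const 2)
  have parent := Primrec.snd.comp (unp (Primrec.nat_sub.comp c (Primrec.const 1)))
  have node := Primrec.encode.comp
    (Primrec.list_reverse.comp ((Primrec.ofNat (List ℕ)).comp c))
  -- The formula follows the disjuncts of `treeEdge`; the oracle is consulted only for membership of
  -- a child in `A`.
  exact OracleDecidable.computableOnBaire_charFun <|
    (OracleDecidable.of_primrecPred (eq row (.const 0))).or <|
    (OracleDecidable.of_primrecPred (eq row (.const 1))).or <|
    (OracleDecidable.of_primrecPred <| (eq tag (.const 0)).and <| (Primrec.nat_lt.comp a hm).and <|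
      (eq v a).or (eq v b)).or <|
    (OracleDecidable.of_primrecPred <| (eq tag (.const 1)).and <|
      (eq v (lin (m + 1) j)).or (eq v (lin (m + 2) j))).or <|
    ((OracleDecidable.of_primrecPred (eq tag (.const 2))).and <|
      (OracleDecidable.of_primrecPred (eq v hm)).or <|
      (OracleDecidable.of_primrecPred (eq v (lin (m + 2) j))).or <|
      (OracleDecidable.of_primrecPred (eq v (lin (m + 1) c))).and <|
      (OracleDecidable.of_primrecPred (eq c (.const 0)).not).and <|
      (OracleDecidable.of_primrecPred (eq parent j)).and (.oracle_ne_zero node)).or <|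
    OracleDecidable.of_primrecPred <| (eq tag (.const 3)).and <|
      (eq v hm).or (eq v (.const (m + 1)))

theorem namesHypergraph_treeHypergraphCode (m : ℕ) (p : Baire) :
    NamesHypergraph (charFun (treeHypergraphCode m p))
      (treeHypergraph m (reversedNodes p)) := by
  refine ⟨Set.univ, treeEdge m (reversedNodes p), ?_, ?_, fun i _ => ?_, Set.image_univ.symm⟩ <;>
    funext v
  · simp [charFun, treeHypergraphCode, treeHypergraph]
  · simp [charFun, treeHypergraphCode]
  · have h : Nat.pair (i + 2) v ∈ treeHypergraphCode m p ↔
        v ∈ treeEdge m (reversedNodes p) i := by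
      simp [treeHypergraphCode]
    by_cases hv : v ∈ treeEdge m (reversedNodes p) i <;> simp [charFun, h, hv]

theorem wf_strongWeihrauchReducible_hpc {k : ℕ} (hk : 2 ≤ k) :
    StrongWeihrauchReducible WF (HPC k) := by
  obtain ⟨m, rfl⟩ := Nat.exists_eq_add_of_le' hk
  refine strongWeihrauchReducible_of_negation (computableOnBaire_treeHypergraphCode m)
    fun p T hp => ⟨_, namesHypergraph_treeHypergraphCode m p, ?_⟩
  have hA (l : List ℕ) : encode l ∈ reversedNodes p ↔ l.reverse ∈ T := by
    obtain rfl : p = charFun (encode '' (T : Set (List ℕ))) := hp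
    rw [reversedNodes, Set.mem_ofPred_eq, charFun_ne_zero_iff, Denumerable.ofNat_encode,
      encode_injective.mem_set_image]
    rfl
  exact not_congr ⟨fun ⟨f, hf⟩ => ⟨_, isProperColoring_of_path hA hf⟩,
    fun ⟨c, hc⟩ => exists_path_of_isProperColoring hA hc⟩

end TreeHypergraph

theorem theorem8 (k : ℕ) (hk : 2 ≤ k) : StrongWeihrauchEquiv (HPC k) WF :=
  ⟨hpc_strongWeihrauchReducible_wf (by omega), wf_strongWeihrauchReducible_hpc hk⟩
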